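/- Let $G$ be a finite set and let $P_1,\dots,P_l$ ($l\ge 1$) be predicates $P_i\subseteq G^{k_i}$, possibly of different arities; put $k_{\min}=\min_i k_i$, $k_{\max}=\max_i k_i$ and assume $k_{\min}\ge 3$. Assume that each $P_i$ supports a balanced pairwise independent distribution, i.e. there is a probability distribution $\mu_i$ on $G^{k_i}$ with $\mu_i(P_i)=1$ such that $\Pr_{x\sim\mu_i}[x_a=g,\ x_b=g']=1/|G|^2$ for all $a\ne b$ and all $g,g'\in G$. Let $(V,\mathcal C)$ be an instance: a finite set $V$ of variables and finitely many constraints $C_1,\dots,C_m$, where $C_c$ consists of a type $t_c\in\{1,\dots,l\}$ and a tuple $(e_{c,1},\dots,e_{c,k_{t_c}})$ of distinct variables, whose underlying set is $E_c\subseteq V$. Let $s\in\mathbb R$ and $0<\delta\le\frac14$, and suppose that the instance is $(s,2+\delta)$-boundary expanding: for every set $M$ of at most $s$ constraints, the number of variables that appear in exactly one constraint of $M$ is at least $\sum_{c\in M}|E_c|-(2+\delta)|M|$. Put $t=\lfloor \delta s/(6k_{\max})\rfloor$ (read as $0$ if negative). Then there is a balanced solution to $t$ rounds of the Sherali--Adams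 hierarchy that satisfies every constraint. That is, there are numbers $X_S(\alpha)\in[0,1]$, for all $S\subseteq V$ with $|S|\le t$ and all $\alpha:S\to G$, such that 1. $X_\emptyset=1$, and $\sum_{\beta:T\to G,\ \beta|_S=\alpha}X_T(\beta)=X_S(\alpha)$ for all $S\subseteq T\subseteq V$ with $|T|\le t$ and all $\alpha:S\to G$; 2. (balanced) if $t\ge1$, then $X_{\{v\}}(v\mapsto g)=1/|G|$ for all $v\in V$ and $g\in G$; 3. (satisfies the constraints) for every constraint $C_c$ with $|E_c|\le t$ (hence for every constraint as soon as $t\ge k_{\max}$, which the notion of a solution to $t$ rounds presupposes) and every $\alpha:E_c\to G$ with $(\alpha(e_{c,1}),\dots,\alpha(e_{c,k_{t_c}}))\notin P_{t_c}$, one has $X_{E_c}(\alpha)=0$. -/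

import Mathlib

namespace CSPSheraliAdams

/-- A distribution `μ` on `G ^ k` (a point of the probability simplex over `Fin k → G`) is balanced
pairwise independent if any two distinct coordinates are jointly uniform on `G × G`. -/
def IsBalancedPairwiseIndependent {G : Type*} [Fintype G] [DecidableEq G] {k : ℕ}
    (μ : (Fin k → G) → ℝ) : Prop :=
  ∀ i j : Fin k, i ≠ j → ∀ g g' : G,
    ∑ x with x i = g ∧ x j = g', μ x = 1 / (Fintype.card G : ℝ) ^ 2

/-- The predicate `P ⊆ G ^ k` supports a balanced pairwise independent distribution. -/
def SupportsBalancedPairwiseIndependent {G : Type*} [Fintype G] [DecidableEq G] {k : ℕ}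
    (P : Set (Fin k → G)) : Prop :=
  ∃ μ : (Fin k → G) → ℝ, μ ∈ stdSimplex ℝ (Fin k → G) ∧ (∀ x, x ∉ P → μ x = 0) ∧
    IsBalancedPairwiseIndependent μ

/-- An instance on the variable set `V` of a CSP whose predicates are indexed by `Fin l` and have
arities `k`: a finite list of constraints, each having a type and a tuple of distinct variables. -/
structure CSPInstance (V : Type*) {l : ℕ} (k : Fin l → ℕ) where
  /-- the number of constraints -/
  m : ℕ
  /-- the type of a constraint, that is, the index of its predicate -/
  type : Fin m → Fin l
  /-- the tuple of variables of a constraint; a variable occurs at most once in a constraint -/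
  tuple : (c : Fin m) → (Fin (k (type c)) ↪ V)

namespace CSPInstance

variable {V : Type*} {l : ℕ} {k : Fin l → ℕ}

/-- The set of variables of a constraint. -/
def scope (I : CSPInstance V k) (c : Fin I.m) : Finset V :=
  Finset.univ.map (I.tuple c)

theorem tuple_mem_scope (I : CSPInstance V k) (c : Fin I.m) (j : Fin (k (I.type c))) :
    I.tuple c j ∈ I.scope c :=
  Finset.mem_map_of_mem _ (Finset.mem_univ j)

/-- The variables that appear in exactly one of the constraints in `M`. -/
def boundary [Fintype V] [DecidableEq V] (I : CSPInstance V k) (M : Finset (Fin I.m)) :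
    Finset V :=
  {v | (M.filter fun c => v ∈ I.scope c).card = 1}

/-- `(s, a)`-boundary expansion: any set `M` of at most `s` constraints has at least
`∑ c ∈ M, |E_c| - a |M|` variables that appear in exactly one of its members. -/
def IsBoundaryExpanding [Fintype V] [DecidableEq V] (I : CSPInstance V k) (s a : ℝ) : Prop :=
  ∀ M : Finset (Fin I.m), (M.card : ℝ) ≤ s →
    (∑ c ∈ M, ((I.scope c).card : ℝ)) - a * M.card ≤ (I.boundary M).card

end CSPInstance

/-- A `t`-local distribution: numbers `X S α ∈ [0, 1]` for all `S ⊆ V` with `|S| ≤ t` and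
`α : S → G`, with `X ∅ = 1` and such that `X S` is the marginal of `X T` whenever `S ⊆ T`
and `|T| ≤ t`. The values of `X` at sets with more than `t` elements play no role. -/
structure IsLocalDistribution {V G : Type*} [DecidableEq V] [Fintype G] [DecidableEq G] (t : ℕ)
    (X : (S : Finset V) → (S → G) → ℝ) : Prop where
  mem_Icc : ∀ S : Finset V, S.card ≤ t → ∀ α : S → G, X S α ∈ Set.Icc (0 : ℝ) 1
  empty : ∀ α : (∅ : Finset V) → G, X ∅ α = 1
  marginal : ∀ (S T : Finset V) (hST : S ⊆ T), T.card ≤ t → ∀ α : S → G,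
    ∑ β : T → G with Finset.restrict₂ (π := fun _ => G) hST β = α, X T β = X S α

/-- A `t`-local distribution is balanced if every `X {v}` is uniform on `G` (the sets `{v}` are
within its range as soon as `1 ≤ t`). -/
def IsBalanced {V G : Type*} [Fintype G] (t : ℕ) (X : (S : Finset V) → (S → G) → ℝ) : Prop :=
  1 ≤ t → ∀ (v : V) (g : G), X {v} (fun _ => g) = 1 / (Fintype.card G : ℝ)

/-- A `t`-local distribution satisfies the constraint `c` if the local distribution on the scope of
`c` vanishes at every assignment that violates `c` (scopes have at most `k_max` elements, so they
are within its range as soon as `k_max ≤ t`). -/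
def Satisfies {V G : Type*} {l : ℕ} {k : Fin l → ℕ} (P : (i : Fin l) → Set (Fin (k i) → G))
    (I : CSPInstance V k) (t : ℕ) (X : (S : Finset V) → (S → G) → ℝ) (c : Fin I.m) : Prop :=
  (I.scope c).card ≤ t → ∀ α : I.scope c → G,
    (fun j => α ⟨I.tuple c j, I.tuple_mem_scope c j⟩) ∉ P (I.type c) → X (I.scope c) α = 0

/-- The largest arity. -/
def kMax {l : ℕ} [NeZero l] (k : Fin l → ℕ) : ℕ := Finset.univ.sup' Finset.univ_nonempty k

/-- The smallest arity. -/
def kMin {l : ℕ} [NeZero l] (k : Fin l → ℕ) : ℕ := Finset.univ.inf' Finset.univ_nonempty k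

end CSPSheraliAdams

/-!
For a set `M` of constraints, weight the uniform distribution on `V → G` by the product over
`c ∈ M` of the density `|G| ^ k_c * μ_c (x ∘ c)` of `μ_c` with respect to the uniform distribution
(`density`). Pairwise independence says that a constraint of `M` with at most two *attached*
variables (variables that lie in `S` or are not in the boundary of `M`) can be dropped from `M`
without changing the marginal on `S` of this weight: conditionally on the values of the attached
variables, its density averages to one (`sum_mul_eq_of_pairwiseIndependent`,
`marginalWeight_erase`).

The local distribution on `S` is the marginal on `S` of the weight of a *closure* of `S`
(`IsClosure`), a set `N` of constraints such that every larger set of at most `s` constraints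
contains a constraint outside `N` that can be dropped. Closures exist: take `N` of maximal
cardinality among the sets of at most `s` constraints that have on average at least three attached
variables per constraint. Boundary expansion bounds the average by `2 + δ + |S| / |N|`, whence
`(1 - δ) |N| ≤ |S|` (`exists_isClosure`). Closures being this small, the union of the closures of
`S` and of `T` has at most `s` elements, so both local distributions are marginals of the weight of
this union, and hence are consistent. If `|S| ≤ 1` then the closure has at most one element, which gives
normalization and balancedness (a single constraint has at most one attached
variable and can be dropped), and the closure of a scope contains the constraint itself, which
is therefore satisfied.
-/

namespace CSPSheraliAdams

open Finset

/-! ### Averaging over a pairwise independent distribution -/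

section Averaging

variable {G : Type*} [Fintype G] [DecidableEq G] {n : ℕ}

theorem card_filter_apply_eq_and_apply_eq {i j : Fin n} (hij : i ≠ j) (g g' : G) :
    #{x : Fin n → G | x i = g ∧ x j = g'} = Fintype.card G ^ (n - 2) := by
  have h : ({x : Fin n → G | x i = g ∧ x j = g'} : Finset (Fin n → G)) =
      Fintype.piFinset fun a => if a = i then {g} else if a = j then {g'} else univ := by
    ext x
    simp only [mem_filter, mem_univ, true_and, Fintype.mem_piFinset]
    constructor
    · rintro ⟨rfl, rfl⟩ a
      split_ifs with h1 h2 <;> simp [*]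
    · intro h
      exact ⟨by simpa using h i, by simpa [hij.symm] using h j⟩
  have hcard : ∀ a : Fin n, #(if a = i then {g} else if a = j then {g'} else univ : Finset G) =
      if a ∈ ({i, j} : Finset (Fin n)) then 1 else Fintype.card G := by
    intro a
    by_cases h1 : a = i
    · simp [h1]
    · by_cases h2 : a = j
      · simp [h2, hij.symm]
      · simp [h1, h2, card_univ]
  rw [h, Fintype.card_piFinset, prod_congr rfl fun a _ => hcard a, prod_ite]
  have hc : (univ.filter fun a => a ∉ ({i, j} : Finset (Fin n))) = ({i, j} : Finset _)ᶜ := by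
    ext a; simp
  rw [hc, prod_const_one, one_mul, prod_const, card_compl, card_pair hij, Fintype.card_fin]

/-- A balanced pairwise independent `μ` integrates functions of two coordinates like the uniform
distribution does. -/
theorem IsBalancedPairwiseIndependent.sum_mul_eq {μ : (Fin n → G) → ℝ}
    (hμ : IsBalancedPairwiseIndependent μ) {i j : Fin n} (hij : i ≠ j) {H : (Fin n → G) → ℝ}
    (hH : ∀ u u', u i = u' i → u j = u' j → H u = H u') :
    (Fintype.card G : ℝ) ^ n * ∑ u, μ u * H u = ∑ u, H u := by
  have hn : 2 ≤ n := by
    have := i.2; have := j.2; have : (i : ℕ) ≠ j := fun h => hij (Fin.ext h); omega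
  rcases isEmpty_or_nonempty G with hG | hG
  · have : IsEmpty (Fin n → G) := ⟨fun u => hG.elim (u i)⟩
    simp
  have hG0 : (Fintype.card G : ℝ) ≠ 0 := by simp
  rw [← sum_fiberwise univ (fun u : Fin n → G => (u i, u j)) fun u => μ u * H u,
    ← sum_fiberwise univ (fun u : Fin n → G => (u i, u j)) H, mul_sum]
  refine sum_congr rfl fun p _ => ?_
  have key : ∀ ν : (Fin n → G) → ℝ, ∑ u with (u i, u j) = p, ν u * H u =
      (∑ u with u i = p.1 ∧ u j = p.2, ν u) * H fun a => if a = i then p.1 else p.2 := by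
    intro ν
    rw [sum_mul]
    refine sum_congr (by ext; simp [Prod.ext_iff]) fun u hu => ?_
    obtain ⟨h1, h2⟩ := (mem_filter.1 hu).2
    rw [hH u (fun a => if a = i then p.1 else p.2)
      (by simpa using h1) (by simpa [hij.symm] using h2)]
  have h1 := key fun _ => 1
  simp only [one_mul, sum_const, card_filter_apply_eq_and_apply_eq hij, nsmul_eq_mul,
    mul_one] at h1
  rw [key, h1, hμ i j hij, ← mul_assoc]
  congr 1
  obtain ⟨m, rfl⟩ := Nat.exists_eq_add_of_le hn
  rw [Nat.add_sub_cancel_left, Nat.cast_pow]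
  field_simp
  ring

/-- The density of a balanced pairwise independent distribution on the coordinates in the range of
`e` averages to one against any `h` that depends on at most two of these coordinates. -/
theorem sum_mul_eq_of_pairwiseIndependent {V : Type*} [Fintype V] [DecidableEq V]
    {μ : (Fin n → G) → ℝ} (hμ : IsBalancedPairwiseIndependent μ) (e : Fin n ↪ V) {i j : Fin n}
    (hij : i ≠ j) {h : (V → G) → ℝ}
    (hh : ∀ x u, u i = x (e i) → u j = x (e j) → h (Function.extend e u x) = h x) :
    ∑ x, (Fintype.card G : ℝ) ^ n * μ (x ∘ e) * h x = ∑ x, h x := by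
  have hH : ∀ u u' : Fin n → G, u i = u' i → u j = u' j →
      ∑ x with x ∘ e = u, h x = ∑ x with x ∘ e = u', h x := by
    -- overwriting the coordinates in the range of `e` by `u'` matches the two fibers
    intro u u' hi hj
    have aux : ∀ (w w' : Fin n → G) (x : V → G), x ∘ e = w →
        Function.extend e w (Function.extend e w' x) = x := by
      rintro w w' x rfl
      funext v
      by_cases hv : ∃ a, e a = v
      · obtain ⟨a, rfl⟩ := hv
        simp [e.injective.extend_apply]
      · rw [Function.extend_apply' _ _ _ hv, Function.extend_apply' _ _ _ hv]
    refine sum_nbij' (fun x => Function.extend e u' x) (fun x => Function.extend e u x)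
      ?_ ?_ ?_ ?_ ?_
    · intro x _
      simpa using Function.extend_comp e.injective u' x
    · intro x _
      simpa using Function.extend_comp e.injective u x
    · intro x hx
      exact aux u u' x (by simpa using hx)
    · intro x hx
      exact aux u' u x (by simpa using hx)
    · intro x hx
      have hx' : x ∘ e = u := by simpa using hx
      refine (hh x u' ?_ ?_).symm
      · rw [← hi, ← hx']; rfl
      · rw [← hj, ← hx']; rfl
  have := hμ.sum_mul_eq hij (H := fun u => ∑ x with x ∘ e = u, h x) hH
  rw [sum_fiberwise univ (fun x : V → G => x ∘ e) h] at this
  rw [← this, ← sum_fiberwise univ (fun x : V → G => x ∘ e), mul_sum]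
  refine sum_congr rfl fun u _ => ?_
  rw [mul_sum, mul_sum]
  refine sum_congr rfl fun x hx => ?_
  rw [(mem_filter.1 hx).2, mul_assoc]

end Averaging

namespace CSPInstance

variable {V : Type*} {l : ℕ} {k : Fin l → ℕ}

theorem card_scope (I : CSPInstance V k) (c : Fin I.m) : #(I.scope c) = k (I.type c) := by
  simp [scope]

variable [Fintype V] [DecidableEq V]

/-! ### Closures under boundary expansion -/

/-- Relative to the set `M` of constraints, the variables of `c` over which one cannot average
freely when only the values on `S` are kept: those in `S`, and those that are not in the
boundary of `M`. -/
def attached (I : CSPInstance V k) (S : Finset V) (M : Finset (Fin I.m)) (c : Fin I.m) :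
    Finset V :=
  {v ∈ I.scope c | v ∈ S ∨ v ∉ I.boundary M}

theorem attached_mono (I : CSPInstance V k) (S : Finset V) {N M : Finset (Fin I.m)} (h : N ⊆ M)
    {c : Fin I.m} (hc : c ∈ N) : I.attached S N c ⊆ I.attached S M c := by
  intro v hv
  simp only [attached, boundary, mem_filter, mem_univ, true_and] at hv ⊢
  refine ⟨hv.1, hv.2.imp_right fun h1 h2 => h1 ?_⟩
  have hle : #{c ∈ N | v ∈ I.scope c} ≤ #{c ∈ M | v ∈ I.scope c} :=
    card_le_card (filter_subset_filter _ h)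
  have hpos : 0 < #{c ∈ N | v ∈ I.scope c} := card_pos.2 ⟨c, mem_filter.2 ⟨hc, hv.1⟩⟩
  omega

/-- A variable of `c` that is not attached lies in no other constraint of `M`. -/
theorem notMem_scope_of_notMem_attached (I : CSPInstance V k) {S : Finset V}
    {M : Finset (Fin I.m)} {c c' : Fin I.m} (hc : c ∈ M) (hc' : c' ∈ M) (hne : c' ≠ c) {v : V}
    (hv : v ∈ I.scope c) (hva : v ∉ I.attached S M c) : v ∉ I.scope c' := by
  intro hv'
  have hb : v ∈ I.boundary M := by
    by_contra hb
    exact hva (mem_filter.2 ⟨hv, Or.inr hb⟩)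
  simp only [boundary, mem_filter, mem_univ, true_and] at hb
  exact hne (card_le_one.1 hb.le _ (mem_filter.2 ⟨hc', hv'⟩) _ (mem_filter.2 ⟨hc, hv⟩))

theorem sum_card_attached_add_card_boundary_le (I : CSPInstance V k) (S : Finset V)
    (M : Finset (Fin I.m)) :
    ∑ c ∈ M, #(I.attached S M c) + #(I.boundary M) ≤ ∑ c ∈ M, #(I.scope c) + #S := by
  have h1 : I.boundary M \ S ⊆
      M.biUnion fun c => {v ∈ I.scope c | ¬ (v ∈ S ∨ v ∉ I.boundary M)} := by
    intro v hv
    obtain ⟨hb, hS⟩ := mem_sdiff.1 hv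
    have hb' : #{c ∈ M | v ∈ I.scope c} = 1 := (mem_filter.1 hb).2
    obtain ⟨c, hc⟩ := card_pos.1 (hb'.symm ▸ Nat.one_pos)
    rw [mem_filter] at hc
    exact mem_biUnion.2 ⟨c, hc.1, mem_filter.2 ⟨hc.2, by tauto⟩⟩
  have h2 := (card_le_card h1).trans card_biUnion_le
  have h3 : ∑ c ∈ M, #(I.scope c) = ∑ c ∈ M, #(I.attached S M c) +
      ∑ c ∈ M, #{v ∈ I.scope c | ¬ (v ∈ S ∨ v ∉ I.boundary M)} := by
    rw [← sum_add_distrib]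
    exact sum_congr rfl fun c _ => (card_filter_add_card_filter_not _).symm
  have h4 := le_card_sdiff S (I.boundary M)
  omega

theorem attached_subset_of_card_le_one (I : CSPInstance V k) (S : Finset V) {M : Finset (Fin I.m)}
    (hM : #M ≤ 1) {c : Fin I.m} (hc : c ∈ M) : I.attached S M c ⊆ S := by
  intro v hv
  obtain ⟨hvc, hv⟩ := mem_filter.1 hv
  refine hv.resolve_right (not_not_intro (mem_filter.2 ⟨mem_univ v, le_antisymm ?_ ?_⟩))
  · exact (card_filter_le _ _).trans hM
  · exact card_pos.2 ⟨c, mem_filter.2 ⟨hc, hvc⟩⟩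

/-- `N` is a closure of `S` (up to size `s`) if every strictly larger set `M` of at most `s`
constraints contains a constraint outside `N` with at most two attached variables. -/
def IsClosure (I : CSPInstance V k) (s : ℝ) (S : Finset V) (N : Finset (Fin I.m)) : Prop :=
  ∀ M, N ⊂ M → (#M : ℝ) ≤ s → ∃ c ∈ M, c ∉ N ∧ #(I.attached S M c) ≤ 2

theorem exists_isClosure (I : CSPInstance V k) {s δ : ℝ} (hs : 0 ≤ s)
    (hI : I.IsBoundaryExpanding s (2 + δ)) (S : Finset V) :
    ∃ N, I.IsClosure s S N ∧ (1 - δ) * #N ≤ #S := by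
  classical
  obtain ⟨N, hN, hmax⟩ := exists_max_image
    {M : Finset (Fin I.m) | (#M : ℝ) ≤ s ∧ 3 * #M ≤ ∑ c ∈ M, #(I.attached S M c)} card
    ⟨∅, by simp [hs]⟩
  simp only [mem_filter, mem_univ, true_and] at hN hmax
  refine ⟨N, fun M hNM hM => ?_, ?_⟩
  · by_contra! h
    have hsub := hNM.subset
    have h1 : ∑ c ∈ N, #(I.attached S N c) ≤ ∑ c ∈ N, #(I.attached S M c) :=
      sum_le_sum fun c hc => card_le_card (I.attached_mono S hsub hc)
    have h2 : #(M \ N) * 3 ≤ ∑ c ∈ M \ N, #(I.attached S M c) := by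
      rw [← smul_eq_mul]
      exact card_nsmul_le_sum _ _ _ fun c hc => h c (mem_sdiff.1 hc).1 (mem_sdiff.1 hc).2
    have h3 := sum_sdiff (f := fun c => #(I.attached S M c)) hsub
    have h4 := card_sdiff_add_card_eq_card hsub
    have h5 := hmax M ⟨hM, by omega⟩
    exact absurd (card_lt_card hNM) h5.not_gt
  · have h1 := hI N hN.1
    have h2 : ((∑ c ∈ N, #(I.attached S N c) + #(I.boundary N) : ℕ) : ℝ) ≤
        ((∑ c ∈ N, #(I.scope c) + #S : ℕ) : ℝ) :=
      Nat.cast_le.2 (I.sum_card_attached_add_card_boundary_le S N)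
    have h3 : ((3 * #N : ℕ) : ℝ) ≤ ((∑ c ∈ N, #(I.attached S N c) : ℕ) : ℝ) := Nat.cast_le.2 hN.2
    push_cast at h2 h3
    linarith

/-- A closure of a superset of the scope of a constraint contains the constraint, since all of the
at least three variables of the constraint are attached. -/
theorem IsClosure.mem_of_scope_subset {I : CSPInstance V k} {s : ℝ} {S : Finset V}
    {N : Finset (Fin I.m)} (h : I.IsClosure s S N) (hN : (#N : ℝ) + 1 ≤ s) {c : Fin I.m}
    (hc : I.scope c ⊆ S) (h3 : 3 ≤ #(I.scope c)) : c ∈ N := by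
  by_contra hcN
  obtain ⟨c', hc', hc'N, hle⟩ := h (insert c N) (ssubset_insert hcN)
    (by rw [card_insert_of_notMem hcN]; exact_mod_cast hN)
  obtain rfl : c' = c := by simpa [hc'N] using hc'
  have : I.attached S (insert c' N) c' = I.scope c' :=
    filter_true_of_mem fun v hv => Or.inl (hc hv)
  rw [this] at hle
  omega

/-! ### Marginals of the weights -/

variable {G : Type*} [Fintype G] [DecidableEq G]

/-- The density of `μ`, on the variables of the constraint `c`, with respect to the uniform
distribution on `V → G`. -/
def density (I : CSPInstance V k) (μ : (i : Fin l) → (Fin (k i) → G) → ℝ) (c : Fin I.m)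
    (x : V → G) : ℝ :=
  (Fintype.card G : ℝ) ^ k (I.type c) * μ (I.type c) (x ∘ I.tuple c)

/-- The marginal on `S` of the uniform distribution weighted by the densities of the constraints
in `M`. -/
noncomputable def marginalWeight (I : CSPInstance V k) (μ : (i : Fin l) → (Fin (k i) → G) → ℝ)
    (M : Finset (Fin I.m)) (S : Finset V) (α : S → G) : ℝ :=
  ((Fintype.card G : ℝ) ^ Fintype.card V)⁻¹ *
    ∑ x : V → G with S.restrict x = α, ∏ c ∈ M, I.density μ c x

variable {I : CSPInstance V k} {μ : (i : Fin l) → (Fin (k i) → G) → ℝ}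

theorem marginalWeight_nonneg (hμ : ∀ i x, 0 ≤ μ i x) (M : Finset (Fin I.m)) (S : Finset V)
    (α : S → G) : 0 ≤ I.marginalWeight μ M S α :=
  mul_nonneg (by positivity) (sum_nonneg fun _ _ => prod_nonneg fun _ _ =>
    mul_nonneg (by positivity) (hμ _ _))

theorem sum_marginalWeight (M : Finset (Fin I.m)) {S T : Finset V} (hST : S ⊆ T) (α : S → G) :
    ∑ β : T → G with Finset.restrict₂ (π := fun _ => G) hST β = α, I.marginalWeight μ M T β =
      I.marginalWeight μ M S α := by
  simp only [marginalWeight, ← mul_sum]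
  congr 1
  rw [← sum_fiberwise_of_maps_to (s := {x : V → G | S.restrict x = α})
    (t := {β : T → G | Finset.restrict₂ (π := fun _ => G) hST β = α}) (g := T.restrict)]
  · refine sum_congr rfl fun β hβ => sum_congr ?_ fun _ _ => rfl
    ext x
    simp only [mem_filter, mem_univ, true_and] at hβ ⊢
    refine ⟨?_, fun h => h.2⟩
    rintro rfl
    exact ⟨hβ, rfl⟩
  · intro x hx
    simp only [mem_filter, mem_univ, true_and] at hx ⊢
    exact hx

/-- A constraint with at most two attached variables can be dropped. -/
theorem marginalWeight_erase (hμ : ∀ i, IsBalancedPairwiseIndependent (μ i))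
    {M : Finset (Fin I.m)} {c : Fin I.m} (hc : c ∈ M) (h2 : 2 ≤ k (I.type c)) {S : Finset V}
    (h : #(I.attached S M c) ≤ 2) (α : S → G) :
    I.marginalWeight μ M S α = I.marginalWeight μ (M.erase c) S α := by
  -- at most two positions of `c` carry attached variables; pad them to exactly two
  have hA : #{a | I.tuple c a ∈ I.attached S M c} ≤ 2 := by
    refine le_trans ?_ h
    exact card_le_card_of_injOn (I.tuple c) (fun a ha => (mem_filter.1 ha).2)
      (I.tuple c).injective.injOn
  obtain ⟨B, hAB, hB⟩ := exists_superset_card_eq hA (by simpa using h2)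
  obtain ⟨i, j, hij, rfl⟩ := card_eq_two.1 hB
  unfold marginalWeight
  congr 1
  rw [sum_filter, sum_filter]
  refine Eq.trans ?_ (sum_mul_eq_of_pairwiseIndependent (hμ (I.type c)) (I.tuple c) hij ?_)
  · refine sum_congr rfl fun x _ => ?_
    split_ifs
    · rw [← mul_prod_erase M _ hc]
      rfl
    · simp
  · intro x u hi hj
    have agree : ∀ v, (v ∈ S ∨ ∃ c' ∈ M.erase c, v ∈ I.scope c') →
        Function.extend (I.tuple c) u x v = x v := by
      intro v hv
      by_cases hvr : ∃ a, I.tuple c a = v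
      · obtain ⟨a, rfl⟩ := hvr
        rw [(I.tuple c).injective.extend_apply]
        have ha : I.tuple c a ∈ I.attached S M c := by
          by_contra hna
          rcases hv with hv | ⟨c', hc', hv⟩
          · exact hna (mem_filter.2 ⟨I.tuple_mem_scope c a, Or.inl hv⟩)
          · exact I.notMem_scope_of_notMem_attached hc (mem_of_mem_erase hc')
              (ne_of_mem_erase hc') (I.tuple_mem_scope c a) hna hv
        have : a ∈ ({i, j} : Finset _) := hAB (mem_filter.2 ⟨mem_univ _, ha⟩)
        rcases mem_insert.1 this with rfl | h
        · exact hi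
        · rw [mem_singleton.1 h]
          exact hj
      · rw [Function.extend_apply' _ _ _ hvr]
    have hr : S.restrict (π := fun _ => G) (Function.extend (I.tuple c) u x) = S.restrict x :=
      funext fun v => agree v (Or.inl v.2)
    rw [hr]
    congr 1
    refine prod_congr rfl fun c' hc' => ?_
    unfold density
    congr 2
    exact funext fun a => agree _ (Or.inr ⟨c', hc', I.tuple_mem_scope c' a⟩)

theorem IsClosure.marginalWeight_eq {s : ℝ} {S : Finset V} {N : Finset (Fin I.m)}
    (hN : I.IsClosure s S N) (hμ : ∀ i, IsBalancedPairwiseIndependent (μ i))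
    (hk : ∀ i, 2 ≤ k i) {M : Finset (Fin I.m)} (hNM : N ⊆ M) (hM : (#M : ℝ) ≤ s) (α : S → G) :
    I.marginalWeight μ M S α = I.marginalWeight μ N S α := by
  induction M using Finset.strongInduction with
  | H M ih =>
    rcases hNM.eq_or_ssubset with rfl | hlt
    · rfl
    obtain ⟨c, hc, hcN, hle⟩ := hN M hlt hM
    rw [marginalWeight_erase hμ hc (hk _) hle]
    refine ih _ (erase_ssubset hc) (subset_erase.2 ⟨hNM, hcN⟩) (le_trans ?_ hM)
    exact_mod_cast card_le_card (erase_subset c M)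

theorem marginalWeight_empty_empty [Nonempty G] (α : (∅ : Finset V) → G) :
    I.marginalWeight μ ∅ ∅ α = 1 := by
  have h : ∀ x : V → G, (∅ : Finset V).restrict x = α := fun x => Subsingleton.elim _ _
  simp [marginalWeight, h]

theorem marginalWeight_empty_singleton [Nonempty G] (v : V) (g : G) :
    I.marginalWeight μ ∅ {v} (fun _ => g) = 1 / (Fintype.card G : ℝ) := by
  have h : ({x : V → G | ({v} : Finset V).restrict x = fun _ => g} : Finset (V → G)) =
      Fintype.piFinset fun w => if w = v then {g} else univ := by
    ext x
    simp only [mem_filter, mem_univ, true_and, Fintype.mem_piFinset, funext_iff]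
    constructor
    · intro h w
      split_ifs with hw
      · subst hw
        simpa using h ⟨w, mem_singleton_self w⟩
      · simp
    · rintro h ⟨w, hw⟩
      obtain rfl := mem_singleton.1 hw
      simpa using h w
  have hcard : Fintype.card G * #({x : V → G | ({v} : Finset V).restrict x = fun _ => g} :
      Finset (V → G)) = Fintype.card G ^ Fintype.card V := by
    rw [h, Fintype.card_piFinset, ← mul_prod_erase univ _ (mem_univ v)]
    have : ∀ w ∈ univ.erase v, #(if w = v then {g} else univ : Finset G) = Fintype.card G := by
      intro w hw
      simp [ne_of_mem_erase hw, card_univ]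
    rw [prod_congr rfl this]
    simp only [if_true, card_singleton, one_mul, prod_const]
    rw [← pow_succ', card_erase_of_mem (mem_univ v), card_univ,
      Nat.sub_add_cancel (Fintype.card_pos_iff.2 ⟨v⟩)]
  have hG0 : (Fintype.card G : ℝ) ≠ 0 := by simp
  have hcard' := congrArg (Nat.cast (R := ℝ)) hcard
  push_cast at hcard'
  unfold marginalWeight
  rw [← hcard']
  simp only [prod_empty, sum_const, nsmul_eq_mul, mul_one]
  have : (#({x : V → G | ({v} : Finset V).restrict x = fun _ => g} : Finset (V → G)) : ℝ) ≠ 0 := by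
    intro h0
    rw [h0, mul_zero] at hcard'
    exact pow_ne_zero _ hG0 hcard'.symm
  field_simp

end CSPInstance

/-! ### The local distribution -/

open CSPInstance in
/-- The local distribution on `S` is the marginal of the weight of a closure of `S`. A closure has
at most `4 / 3 * |S|` elements, so `3 * t ≤ s` leaves room for the union of two closures, and for
adding a constraint to the closure of its scope. -/
theorem exists_isLocalDistribution {G : Type*} [Fintype G] [DecidableEq G] [Nonempty G] {l : ℕ}
    {k : Fin l → ℕ} (P : (i : Fin l) → Set (Fin (k i) → G)) (hk : ∀ i, 3 ≤ k i)
    (hP : ∀ i, SupportsBalancedPairwiseIndependent (P i))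
    {V : Type*} [Fintype V] [DecidableEq V] (I : CSPInstance V k) {s δ : ℝ} (hs : 0 ≤ s)
    (hδ : δ ≤ 1 / 4) (hI : I.IsBoundaryExpanding s (2 + δ)) {t : ℕ} (ht : 3 * (t : ℝ) ≤ s) :
    ∃ X : (S : Finset V) → (S → G) → ℝ,
      IsLocalDistribution t X ∧ IsBalanced t X ∧ ∀ c : Fin I.m, Satisfies P I t X c := by
  choose μ hμs hμP hμ using hP
  choose N hN hNc using I.exists_isClosure hs hI
  have hN3 : ∀ S, 3 * (#(N S) : ℝ) ≤ 4 * #S := by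
    intro S
    have := hNc S
    have h0 : (0 : ℝ) ≤ #(N S) := by positivity
    nlinarith
  have hk2 : ∀ i, 2 ≤ k i := fun i => le_trans (by norm_num) (hk i)
  have hμ0 : ∀ i x, 0 ≤ μ i x := fun i => (hμs i).1
  have hX : ∀ {S : Finset V} {M : Finset (Fin I.m)}, N S ⊆ M → (#M : ℝ) ≤ s → ∀ α : S → G,
      I.marginalWeight μ M S α = I.marginalWeight μ (N S) S α :=
    fun hNM hM α => (hN _).marginalWeight_eq hμ hk2 hNM hM α
  have hempty : ∀ α : (∅ : Finset V) → G, I.marginalWeight μ (N ∅) ∅ α = 1 := by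
    intro α
    have h : N ∅ = ∅ := by
      have h := hN3 ∅
      norm_cast at h
      simpa using h
    rw [h, marginalWeight_empty_empty]
  have hmarg : ∀ (S T : Finset V) (hST : S ⊆ T), #T ≤ t → ∀ α : S → G,
      ∑ β : T → G with Finset.restrict₂ (π := fun _ => G) hST β = α,
        I.marginalWeight μ (N T) T β = I.marginalWeight μ (N S) S α := by
    intro S T hST hT α
    have hU : (#(N S ∪ N T) : ℝ) ≤ s := by
      have h1 : (#(N S ∪ N T) : ℝ) ≤ #(N S) + #(N T) := mod_cast card_union_le _ _
      have h2 : (#S : ℝ) ≤ t := mod_cast (card_le_card hST).trans hT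
      have h3 : (#T : ℝ) ≤ t := mod_cast hT
      linarith [hN3 S, hN3 T]
    rw [← hX subset_union_left hU, ← sum_marginalWeight _ hST]
    exact sum_congr rfl fun β _ => (hX subset_union_right hU β).symm
  refine ⟨fun S α => I.marginalWeight μ (N S) S α, ⟨fun S hS α => ?_, hempty, hmarg⟩, ?_, ?_⟩
  · refine ⟨marginalWeight_nonneg hμ0 _ _ _, ?_⟩
    rw [← hempty (Finset.restrict₂ (π := fun _ => G) (empty_subset S) α),
      ← hmarg ∅ S (empty_subset S) hS]
    exact single_le_sum (f := fun β => I.marginalWeight μ (N S) S β)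
      (fun β _ => marginalWeight_nonneg hμ0 _ _ _) (mem_filter.2 ⟨mem_univ α, rfl⟩)
  · intro _ v g
    have hle : #(N {v}) ≤ 1 := by
      have h := hN3 {v}
      norm_cast at h
      rw [card_singleton] at h
      omega
    show I.marginalWeight μ (N {v}) {v} (fun _ => g) = _
    rw [← marginalWeight_empty_singleton (I := I) (μ := μ) v g]
    rcases (N {v}).eq_empty_or_nonempty with h | ⟨c, hc⟩
    · rw [h]
    · have hatt := card_le_card (I.attached_subset_of_card_le_one {v} hle hc)
      rw [card_singleton] at hatt
      rw [marginalWeight_erase hμ hc (hk2 _) (by omega)]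
      congr 1
      rw [← card_eq_zero, card_erase_of_mem hc]
      omega
  · intro c hct α hα
    have h3 : 3 ≤ #(I.scope c) := I.card_scope c ▸ hk _
    have hcN : c ∈ N (I.scope c) := by
      refine (hN _).mem_of_scope_subset ?_ subset_rfl h3
      have h1 : (#(I.scope c) : ℝ) ≤ t := mod_cast hct
      have h2 : (3 : ℝ) ≤ #(I.scope c) := mod_cast h3
      linarith [hN3 (I.scope c)]
    refine mul_eq_zero_of_right _ (sum_eq_zero fun x hx => prod_eq_zero hcN ?_)
    refine mul_eq_zero_of_right _ (hμP _ _ fun hx' => hα ?_)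
    rw [← (mem_filter.1 hx).2]
    exact hx'

end CSPSheraliAdams

theorem theorem4 {G : Type*} [Fintype G] [DecidableEq G] {l : ℕ} [NeZero l]
    (k : Fin l → ℕ) (P : (i : Fin l) → Set (Fin (k i) → G))
    (hk : 3 ≤ CSPSheraliAdams.kMin k)
    (hP : ∀ i, CSPSheraliAdams.SupportsBalancedPairwiseIndependent (P i))
    {V : Type*} [Fintype V] [DecidableEq V] (I : CSPSheraliAdams.CSPInstance V k)
    (s δ : ℝ) (hδ : 0 < δ) (hδ' : δ ≤ 1 / 4) (hI : I.IsBoundaryExpanding s (2 + δ))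
    (t : ℕ) (ht : t = ⌊δ * s / (6 * (CSPSheraliAdams.kMax k : ℝ))⌋₊) :
    ∃ X : (S : Finset V) → (S → G) → ℝ,
      CSPSheraliAdams.IsLocalDistribution t X ∧
      CSPSheraliAdams.IsBalanced t X ∧
      ∀ c : Fin I.m, CSPSheraliAdams.Satisfies P I t X c := by
  have hk3 : ∀ i, 3 ≤ k i := fun i => hk.trans (Finset.inf'_le k (Finset.mem_univ i))
  have hG : Nonempty G := by
    obtain ⟨μ, hμ, -⟩ := hP 0
    by_contra hG
    have : IsEmpty (Fin (k 0) → G) := ⟨fun x => hG ⟨x ⟨0, by have := hk3 0; omega⟩⟩⟩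
    simpa using hμ.2
  -- For negative `s` the expansion hypothesis is void, but its inequality holds for `M = ∅` anyway.
  have hI' : I.IsBoundaryExpanding (max s 0) (2 + δ) := by
    intro M hM
    rcases le_max_iff.1 hM with h | h
    · exact hI M h
    · obtain rfl : M = ∅ := by simpa using h
      simp
  refine CSPSheraliAdams.exists_isLocalDistribution P hk3 hP I (le_max_right s 0) hδ' hI' ?_
  have hK : (3 : ℝ) ≤ CSPSheraliAdams.kMax k :=
    mod_cast (hk3 0).trans (Finset.le_sup' k (Finset.mem_univ 0))
  have hs : s ≤ max s 0 := le_max_left s 0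
  have hs0 : 0 ≤ max s 0 := le_max_right s 0
  have hle : δ * s / (6 * (CSPSheraliAdams.kMax k : ℝ)) ≤ max s 0 / 3 := by
    rw [div_le_iff₀ (by positivity)]
    nlinarith [mul_le_mul_of_nonneg_left hs hδ.le]
  have ht' : (t : ℝ) ≤ max s 0 / 3 :=
    ht ▸ (Nat.cast_le.2 (Nat.floor_le_floor hle)).trans (Nat.floor_le (by positivity))
  linarith
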